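/- Let $p,q\ge 1$ be integers. For $r\in\{p,q\}$ let $\mathbb{T}_r$ be the homogeneous tree with degree $r+1$, drawn in horocycles $H_k$, $k\in\mathbb{Z}$: every vertex $x\in H_k$ has exactly one neighbour $x^-$ (its predecessor) in $H_{k-1}$ and $r$ neighbours (its successors) in $H_{k+1}$. Write $\mathfrak{h}(x)=k$ if $x\in H_k$. Let $\mathsf{Aff}(\mathbb{T}_r)$ be the group of all automorphisms $g$ of $\mathbb{T}_r$ with $g(x^-)=(gx)^-$ for all $x$, with the topology of pointwise convergence, and let $\Phi(g)=\mathfrak{h}(gx)-\mathfrak{h}(x)$, which does not depend on the vertex $x$. Let $$\mathcal{A}(p,q)=\{(g_1,g_2)\in\mathsf{Aff}(\mathbb{T}_p)\times\mathsf{Aff}(\mathbb{T}_q):\Phi(g_1)+\Phi(g_2)=0\},$$ a locally compact group, and put $\Phi(g)=\Phi(g_1)=-\Phi(g_2)$ for $g=(g_1,g_2)\in\mathcal{A}(p,q)$. The Diestel--Leader graph $\mathsf{DL}(p,q)$ has vertex set $\{(x_1,x_2)\in\mathbb{T}_p\times\mathbb{T}_q:\mathfrak{h}(x_1)+\mathfrak{h}(x_2)=0\}$,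 with $(x_1,x_2)\sim(y_1,y_2)$ if and only if $x_1\sim y_1$ and $x_2\sim y_2$. The modular function of a locally compact group $G$ with left Haar measure $\lambda$ is $\Delta_G(g)=\lambda(Ug)/\lambda(U)$, where $U\subset G$ is any non-empty open set with compact closure; $G$ is unimodular if $\Delta_G\equiv 1$. A connected graph with bounded vertex degrees is amenable if $\inf|\partial F|/|F|=0$, the infimum being over all non-empty finite sets $F$ of vertices, where $\partial F$ is the set of edges joining $F$ to its complement. Then: 1. $\Delta_{\mathcal{A}(p,q)}(g)=(p/q)^{\Phi(g)}$ for every $g\in\mathcal{A}(p,q)$. 2. $\mathcal{A}(p,q)$ is unimodular if and only if $p=q$. 3. $\mathsf{DL}(p,q)$ is amenable if and only if $p=q$. -/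

import Mathlib

open MeasureTheory MeasureTheory.Measure Topology
open scoped NNReal ENNReal

/-! ### Topology of pointwise convergence on the automorphism group of a graph -/

namespace SimpleGraph

variable {V : Type*} {X : SimpleGraph V}

/-- The topology of pointwise convergence on `Aut(X)` (the vertex set being discrete). -/
instance autTopologicalSpace : TopologicalSpace (X ≃g X) :=
  TopologicalSpace.induced (fun (g : X ≃g X) (v : V) => g v)
    (@Pi.topologicalSpace V (fun _ => V) (fun _ => ⊥))

theorem continuous_aut_eval (v : V) :
    @Continuous (X ≃g X) V _ ⊥ (fun g => g v) := by
  let _ : TopologicalSpace V := ⊥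
  exact (continuous_apply v).comp continuous_induced_dom

theorem isOpen_aut_eval_eq (v w : V) : IsOpen {g : X ≃g X | g v = w} := by
  let _ : TopologicalSpace V := ⊥
  have _ : DiscreteTopology V := ⟨rfl⟩
  exact (isOpen_discrete ({w} : Set V)).preimage (continuous_aut_eval v)

theorem continuous_aut_iff {Y : Type*} [TopologicalSpace Y] {f : Y → (X ≃g X)} :
    Continuous f ↔ ∀ v w, IsOpen {y | f y v = w} := by
  let _ : TopologicalSpace V := ⊥
  have _ : DiscreteTopology V := ⟨rfl⟩
  constructor
  · intro hf v w
    exact (isOpen_aut_eval_eq v w).preimage hf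
  · intro h
    refine continuous_induced_rng.2 (continuous_pi fun v => ?_)
    exact continuous_discrete_rng.2 fun w => h v w

instance aut_isTopologicalGroup : IsTopologicalGroup (X ≃g X) where
  continuous_mul := by
    refine continuous_aut_iff.2 fun v w => ?_
    have : {y : (X ≃g X) × (X ≃g X) | (y.1 * y.2) v = w}
        = ⋃ u : V, {g : X ≃g X | g u = w} ×ˢ {g : X ≃g X | g v = u} := by
      ext ⟨a, b⟩
      simp [RelIso.mul_apply]
    rw [this]
    exact isOpen_iUnion fun u => (isOpen_aut_eval_eq u w).prod (isOpen_aut_eval_eq v u)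
  continuous_inv := by
    refine continuous_aut_iff.2 fun v w => ?_
    have : {g : X ≃g X | g⁻¹ v = w} = {g : X ≃g X | g w = v} := by
      ext g
      constructor
      · rintro rfl
        exact g.apply_symm_apply v
      · rintro rfl
        exact g.symm_apply_apply w
    rw [this]
    exact isOpen_aut_eval_eq w v

/-- `∂F`, the edges of `X` joining `F` to its complement (listed with the endpoint in `F` first). -/
def edgeBoundary (X : SimpleGraph V) (F : Finset V) : Set (V × V) :=
  {e | X.Adj e.1 e.2 ∧ e.1 ∈ F ∧ e.2 ∉ F}

/-- Amenability of a (connected) graph with bounded vertex degrees: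
`inf |∂F| / |F| = 0`, where `F` ranges over the non-empty finite sets of vertices. -/
def IsAmenable (X : SimpleGraph V) : Prop :=
  sInf {r : ℝ | ∃ F : Finset V, F.Nonempty ∧ r = (X.edgeBoundary F).ncard / F.card} = 0

end SimpleGraph

/-! ### The modular function -/

/-- The modular function `Δ(g) = λ(Ug) / λ(U)`, with `λ` a left Haar measure and `U` open with
compact closure (see `modularFunction_spec`). Mathlib's `modularCharacter g` is
`λ(U g⁻¹) / λ(U)`, hence the inverse. -/
noncomputable def modularFunction {G : Type*} [Group G] [TopologicalSpace G]
    [IsTopologicalGroup G] [LocallyCompactSpace G] (g : G) : ℝ≥0 :=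
  modularCharacter g⁻¹

theorem modularFunction_spec {G : Type*} [Group G] [TopologicalSpace G]
    [IsTopologicalGroup G] [LocallyCompactSpace G] [MeasurableSpace G] [BorelSpace G]
    (μ : Measure G) [IsHaarMeasure μ] {U : Set G} (hU : IsOpen U) (hne : U.Nonempty)
    (hc : IsCompact (closure U)) (g : G) :
    (modularFunction g : ℝ≥0∞) = μ ((fun x => x * g) '' U) / μ U := by
  have h1 : μ ((fun x => x * g) '' U) = Measure.map (· * g⁻¹) μ U := by
    rw [Measure.map_apply (measurable_mul_const _) hU.measurableSet]
    congr 1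
    ext x
    constructor
    · rintro ⟨y, hy, rfl⟩
      simpa using hy
    · intro hx
      exact ⟨x * g⁻¹, hx, by simp⟩
  have h0 : μ U ≠ 0 := (hU.measure_pos μ hne).ne'
  have h2 : μ U ≠ ⊤ := ((measure_mono subset_closure).trans_lt hc.measure_lt_top).ne
  have h3 := measure_isHaarMeasure_eq_smul_of_isOpen (Measure.map (· * g⁻¹) μ) μ hU
  rw [h1, h3, ENNReal.eq_div_iff h0 h2, modularFunction]
  change μ U * (modularCharacterFun g⁻¹ : ℝ≥0∞) = _
  rw [modularCharacterFun_eq_haarScalarFactor μ, mul_comm]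
  rfl

/-- A locally compact group is unimodular if its modular function is identically `1`. -/
def IsUnimodularGroup (G : Type*) [Group G] [TopologicalSpace G]
    [IsTopologicalGroup G] [LocallyCompactSpace G] : Prop :=
  ∀ g : G, modularFunction g = 1

namespace DiestelLeader

/-! ### The homogeneous tree with branching number `p`, drawn in horocycles -/

/-- A vertex of the homogeneous tree `𝕋_p` "hanging down" from a point at infinity. The tree is
generated by the predecessor map `pred` below. A vertex in the horocycle `H_k` is addressed by its
line of ancestors: `digit i` is the label in `{0, …, p-1}` of its ancestor in `H_i` among the `p`
successors of the ancestor in `H_{i-1}`; all but finitely many labels are `0`, and `digit i` is set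
to `0` for `i > k`. -/
@[ext]
structure Tree (p : ℕ) where
  level : ℤ
  digit : ℤ → ZMod p
  digit_above : ∀ i, level < i → digit i = 0
  digit_below : ∃ m, ∀ i, i < m → digit i = 0

namespace Tree

variable {p : ℕ}

/-- The Busemann function. -/
def busemann (x : Tree p) : ℤ := x.level

/-- The predecessor `x⁻` of `x`: forget the last label. -/
def pred (x : Tree p) : Tree p where
  level := x.level - 1
  digit := fun i => if i ≤ x.level - 1 then x.digit i else 0
  digit_above := fun i hi => if_neg (by omega)
  digit_below := by
    obtain ⟨m, hm⟩ := x.digit_below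
    refine ⟨m, fun i hi => ?_⟩
    rw [hm i hi, ite_self]

/-- The root `o`, in `H_0`. -/
def root : Tree p where
  level := 0
  digit := fun _ => 0
  digit_above := fun _ _ => rfl
  digit_below := ⟨0, fun _ _ => rfl⟩

theorem busemann_pred (x : Tree p) : x.pred.busemann = x.busemann - 1 := rfl

theorem busemann_iterate_pred (n : ℕ) (x : Tree p) :
    (pred^[n] x).busemann = x.busemann - n := by
  induction n generalizing x with
  | zero => simp
  | succ n ih =>
    rw [Function.iterate_succ_apply, ih, busemann_pred]
    push_cast
    ring

theorem digit_iterate_pred (n : ℕ) (x : Tree p) (i : ℤ) :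
    (pred^[n] x).digit i = if i ≤ x.level - n then x.digit i else 0 := by
  induction n generalizing x with
  | zero =>
    by_cases h : i ≤ x.level
    · simp [h]
    · simp [h, x.digit_above i (by omega)]
  | succ n ih =>
    have e1 : x.pred.level = x.level - 1 := rfl
    have e2 : x.pred.digit i = if i ≤ x.level - 1 then x.digit i else 0 := rfl
    rw [Function.iterate_succ_apply, ih, e1, e2]
    push_cast
    by_cases h : i ≤ x.level - 1 - n
    · rw [if_pos h, if_pos (by omega), if_pos (by omega)]
    · rw [if_neg h, if_neg (by omega)]

/-- Any two vertices have a common ancestor. -/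
theorem exists_common_ancestor (x y : Tree p) : ∃ m n : ℕ, pred^[m] x = pred^[n] y := by
  obtain ⟨a, ha⟩ := x.digit_below
  obtain ⟨b, hb⟩ := y.digit_below
  obtain ⟨c, hc⟩ : ∃ c : ℤ, c < a ∧ c < b ∧ c ≤ x.level ∧ c ≤ y.level :=
    ⟨min (min (a - 1) (b - 1)) (min x.level y.level), by omega, by omega, by omega, by omega⟩
  refine ⟨(x.level - c).toNat, (y.level - c).toNat, Tree.ext ?_ ?_⟩
  · have h1 := busemann_iterate_pred (x.level - c).toNat x
    have h2 := busemann_iterate_pred (y.level - c).toNat y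
    simp only [busemann] at h1 h2
    omega
  · funext i
    rw [digit_iterate_pred, digit_iterate_pred]
    by_cases h : i ≤ c
    · rw [if_pos (by omega), if_pos (by omega), ha i (by omega), hb i (by omega)]
    · rw [if_neg (by omega), if_neg (by omega)]

/-- The tree `𝕋_p` as a graph: every vertex is joined to its predecessor. -/
def graph (p : ℕ) : SimpleGraph (Tree p) where
  Adj x y := x.pred = y ∨ y.pred = x
  symm := ⟨fun _ _ h => h.symm⟩
  loopless := ⟨fun x h => by
    have h1 := congrArg busemann (h.elim id id)
    rw [busemann_pred] at h1
    omega⟩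

/-- Each vertex has exactly `p` successors. -/
theorem card_successors (x : Tree p) : Nat.card {y : Tree p // y.pred = x} = p := by
  refine (Nat.card_congr (β := ZMod p) ?_).trans (Nat.card_zmod p)
  refine
    { toFun := fun y => y.1.digit (x.level + 1)
      invFun := fun a => ⟨⟨x.level + 1, Function.update x.digit (x.level + 1) a, ?_, ?_⟩, ?_⟩
      left_inv := ?_
      right_inv := fun a => by simp }
  · intro i hi
    rw [Function.update_of_ne (by omega)]
    exact x.digit_above i (by omega)
  · obtain ⟨m, hm⟩ := x.digit_below
    refine ⟨min m x.level, fun i hi => ?_⟩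
    rw [Function.update_of_ne (by omega)]
    exact hm i (by omega)
  · refine Tree.ext (by simp [pred]) (funext fun i => ?_)
    by_cases h : i ≤ x.level
    · simp [pred, h, Function.update_of_ne (show i ≠ x.level + 1 by omega)]
    · simp [pred, h, x.digit_above i (by omega)]
  · rintro ⟨y, rfl⟩
    refine Subtype.ext (Tree.ext (by simp [pred]) (funext fun i => ?_))
    by_cases h : i = y.level
    · subst h
      simp [pred]
    · simp only [pred]
      rw [Function.update_of_ne (by omega)]
      by_cases h' : i ≤ y.level - 1
      · rw [if_pos h']
      · rw [if_neg h', y.digit_above i (by omega)]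

theorem reachable_iterate_pred (n : ℕ) (x : Tree p) : (graph p).Reachable x (pred^[n] x) := by
  induction n generalizing x with
  | zero => exact .rfl
  | succ n ih =>
    have h : (graph p).Adj x x.pred := Or.inl rfl
    exact h.reachable.trans (ih _)

/-- The graph is a tree. -/
theorem graph_isTree : (graph p).IsTree where
  connected :=
    { preconnected := fun x y => by
        obtain ⟨m, n, h⟩ := exists_common_ancestor x y
        have h1 := reachable_iterate_pred m x
        rw [h] at h1
        exact h1.trans (reachable_iterate_pred n y).symm
      nonempty := ⟨root⟩ }
  isAcyclic := by
    have key : ∀ x : Tree p, (graph p).IsBridge s(x, x.pred) := by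
      intro x
      rw [SimpleGraph.isBridge_iff]
      intro hr
      have inv : ∀ y : Tree p, ((graph p).deleteEdges {s(x, x.pred)}).Reachable x y →
          ∃ n : ℕ, pred^[n] y = x := by
        rintro y ⟨w⟩
        have hw : ∀ {a b : Tree p}, ((graph p).deleteEdges {s(x, x.pred)}).Walk a b →
            (∃ n : ℕ, pred^[n] a = x) → ∃ n : ℕ, pred^[n] b = x := by
          intro a b w
          induction w with
          | nil => exact id
          | @cons a c b h _ ih =>
            rintro ⟨n, hn⟩
            apply ih
            rw [SimpleGraph.deleteEdges_adj] at h
            obtain ⟨h1 | h1, h2⟩ := h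
            · cases n with
              | zero =>
                simp only [Function.iterate_zero, id] at hn
                subst hn
                subst h1
                exact absurd rfl h2
              | succ n =>
                refine ⟨n, ?_⟩
                rw [← h1, ← Function.iterate_succ_apply]
                exact hn
            · refine ⟨n + 1, ?_⟩
              rw [Function.iterate_succ_apply, h1, hn]
        exact hw w ⟨0, rfl⟩
      obtain ⟨n, hn⟩ := inv _ hr
      have := congrArg busemann hn
      rw [busemann_iterate_pred, busemann_pred] at this
      omega
    rw [SimpleGraph.isAcyclic_iff_forall_adj_isBridge]
    rintro x y (h | h)
    · subst h
      exact key x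
    · subst h
      rw [Sym2.eq_swap]
      exact key y

end Tree

/-! ### The affine group of the tree -/

/-- `Aff(𝕋_p)`: the automorphisms of `𝕋_p` with `g (x⁻) = (g x)⁻` for all `x`. -/
def Aff (p : ℕ) : Subgroup (Tree.graph p ≃g Tree.graph p) where
  carrier := {g | ∀ x : Tree p, g x.pred = (g x).pred}
  mul_mem' := by
    intro a b ha hb x
    rw [RelIso.mul_apply, RelIso.mul_apply, hb, ha]
  one_mem' := fun _ => rfl
  inv_mem' := by
    intro a ha x
    apply a.injective
    rw [ha]
    have h : ∀ y, a (a⁻¹ y) = y := a.apply_symm_apply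
    rw [h, h]

namespace Aff

variable {p : ℕ}

theorem apply_iterate_pred (g : Aff p) (n : ℕ) (x : Tree p) :
    g.1 (Tree.pred^[n] x) = Tree.pred^[n] (g.1 x) := by
  induction n generalizing x with
  | zero => rfl
  | succ n ih => rw [Function.iterate_succ_apply, Function.iterate_succ_apply, ih, g.2]

/-- `Φ(g) = 𝔥(g x) - 𝔥(x)`, here at the root; see `Phi_eq` for the independence of `x`. -/
def Phi (g : Aff p) : ℤ := (g.1 Tree.root).busemann - (Tree.root : Tree p).busemann

theorem Phi_eq (g : Aff p) (x : Tree p) : Phi g = (g.1 x).busemann - x.busemann := by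
  obtain ⟨m, n, h⟩ := Tree.exists_common_ancestor x Tree.root
  have h1 := congrArg Tree.busemann h
  have h2 := congrArg (fun y => (g.1 y).busemann) h
  simp only [apply_iterate_pred, Tree.busemann_iterate_pred] at h1 h2
  rw [Phi]
  omega

theorem Phi_mul (g k : Aff p) : Phi (g * k) = Phi g + Phi k := by
  rw [Phi_eq g (k.1 Tree.root), Phi, Phi]
  change (g.1 (k.1 Tree.root)).busemann - _ = _
  ring

theorem Phi_one : Phi (1 : Aff p) = 0 := sub_self _

theorem Phi_inv (g : Aff p) : Phi g⁻¹ = - Phi g := by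
  have h := Phi_mul g⁻¹ g
  rw [inv_mul_cancel, Phi_one] at h
  omega

theorem continuous_Phi : Continuous (Phi : Aff p → ℤ) := by
  let _ : TopologicalSpace (Tree p) := ⊥
  have _ : DiscreteTopology (Tree p) := ⟨rfl⟩
  have h : Continuous fun g : Aff p => g.1 Tree.root :=
    (SimpleGraph.continuous_aut_eval Tree.root).comp continuous_subtype_val
  have h' : Continuous fun x : Tree p => x.busemann - (Tree.root : Tree p).busemann :=
    continuous_of_discreteTopology
  exact h'.comp h

end Aff

/-- `𝒜(p,q) = {(g₁,g₂) ∈ Aff(𝕋_p) × Aff(𝕋_q) : Φ(g₁) + Φ(g₂) = 0}`. -/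
def A (p q : ℕ) : Subgroup (Aff p × Aff q) where
  carrier := {g | Aff.Phi g.1 + Aff.Phi g.2 = 0}
  mul_mem' := by
    intro a b ha hb
    simp only [Set.mem_ofPred_eq, Prod.fst_mul, Prod.snd_mul, Aff.Phi_mul] at *
    omega
  one_mem' := by simp [Aff.Phi_one]
  inv_mem' := by
    intro a ha
    simp only [Set.mem_ofPred_eq, Prod.fst_inv, Prod.snd_inv, Aff.Phi_inv] at *
    omega

/-- `Φ(g) = Φ(g₁) = -Φ(g₂)` for `g = (g₁,g₂) ∈ 𝒜(p,q)`. -/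
def A.Phi {p q : ℕ} (g : A p q) : ℤ := Aff.Phi g.1.1

theorem A.Phi_eq_neg {p q : ℕ} (g : A p q) : A.Phi g = - Aff.Phi g.1.2 :=
  eq_neg_of_add_eq_zero_left g.2

/-! ### The Diestel-Leader graph -/

/-- The vertices of `DL(p,q)`. -/
def DLVertex (p q : ℕ) : Type :=
  {x : Tree p × Tree q // x.1.busemann + x.2.busemann = 0}

/-- The Diestel-Leader graph `DL(p,q)`. -/
def DL (p q : ℕ) : SimpleGraph (DLVertex p q) where
  Adj x y := (Tree.graph p).Adj x.1.1 y.1.1 ∧ (Tree.graph q).Adj x.1.2 y.1.2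
  symm := ⟨fun _ _ h => ⟨h.1.symm, h.2.symm⟩⟩
  loopless := ⟨fun _ h => h.1.ne rfl⟩

/-! ### Local finiteness and local compactness -/

theorem Tree.finite_pred_fiber {p : ℕ} [NeZero p] (n : ℕ) (a : Tree p) :
    {y : Tree p | pred^[n] y = a}.Finite := by
  induction n generalizing a with
  | zero => simp
  | succ n ih =>
    have h1 : {y : Tree p | y.pred = a}.Finite := by
      apply Nat.finite_of_card_ne_zero
      rw [Set.coe_ofPred, Tree.card_successors]
      exact NeZero.ne p
    refine (h1.biUnion fun b _ => ih b).subset fun y hy => ?_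
    simp only [Set.mem_iUnion, Set.mem_ofPred_eq] at hy ⊢
    exact ⟨pred^[n] y, by rw [← Function.iterate_succ_apply' pred, hy], rfl⟩

/-- `DL(p,q)` is locally finite, so its edge boundaries are finite and `ncard` counts them. -/
theorem DL_edgeBoundary_finite {p q : ℕ} [NeZero p] [NeZero q] (F : Finset (DLVertex p q)) :
    ((DL p q).edgeBoundary F).Finite := by
  have hn : ∀ {r : ℕ} [NeZero r] (x : Tree r), {y | (Tree.graph r).Adj x y}.Finite :=
    fun x => ((Set.finite_singleton x.pred).union (Tree.finite_pred_fiber 1 x)).subset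
      fun y hy => hy.imp Eq.symm id
  have h : ∀ x : DLVertex p q, {y | (DL p q).Adj x y}.Finite := fun x =>
    (((hn x.1.1).prod (hn x.1.2)).preimage Subtype.val_injective.injOn).subset
      fun y hy => ⟨hy.1, hy.2⟩
  refine (F.finite_toSet.biUnion fun x _ => (h x).image (Prod.mk x)).subset ?_
  rintro ⟨x, y⟩ ⟨h1, h2, -⟩
  exact Set.mem_biUnion (Finset.mem_coe.2 h2) ⟨y, h1, rfl⟩

theorem Tree.exists_finite_orbit {p : ℕ} [NeZero p] (x : Tree p) :
    ∃ S : Set (Tree p), S.Finite ∧ ∀ g : Aff p, g.1 root = root → g.1 x ∈ S := by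
  obtain ⟨m, n, h⟩ := exists_common_ancestor x root
  refine ⟨_, finite_pred_fiber m (pred^[n] root), fun g hg => ?_⟩
  simp only [Set.mem_ofPred_eq]
  rw [← Aff.apply_iterate_pred, h, Aff.apply_iterate_pred, hg]

instance Aff.locallyCompactSpace (p : ℕ) [NeZero p] : LocallyCompactSpace (Aff p) := by
  let _ : TopologicalSpace (Tree p) := ⊥
  have _ : DiscreteTopology (Tree p) := ⟨rfl⟩
  choose S hfin hS using Tree.exists_finite_orbit (p := p)
  let ι : Aff p → (Tree p → Tree p) × (Tree p → Tree p) :=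
    fun g => (fun v => g.1 v, fun v => g⁻¹.1 v)
  have hind : IsInducing (fun (g : Aff p) (v : Tree p) => g.1 v) :=
    (IsInducing.mk rfl : IsInducing
      (fun (g : Tree.graph p ≃g Tree.graph p) (v : Tree p) => g v)).comp IsInducing.subtypeVal
  have hcont : Continuous ι := hind.continuous.prodMk (hind.continuous.comp continuous_inv)
  have hι : IsInducing ι :=
    IsInducing.of_comp hcont continuous_fst hind
  let K : Set (Aff p) := {g | g.1 Tree.root = Tree.root}
  let C : Set ((Tree p → Tree p) × (Tree p → Tree p)) :=
    (Set.univ.pi S ×ˢ Set.univ.pi S) ∩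
      {f | f.1 Tree.root = Tree.root ∧ (∀ x, f.1 (f.2 x) = x) ∧ (∀ x, f.2 (f.1 x) = x) ∧
        ∀ x : Tree p, f.1 x.pred = (f.1 x).pred}
  have isOpen_discrete_eval : ∀ u w : Tree p, IsOpen {f : Tree p → Tree p | f u = w} :=
    fun u w => IsOpen.preimage (f := fun f : Tree p → Tree p => f u) (continuous_apply u)
      (isOpen_discrete ({w} : Set (Tree p)))
  have hev : Continuous (fun z : (Tree p → Tree p) × Tree p => z.1 z.2) := by
    rw [continuous_discrete_rng]
    intro w
    have : (fun z : (Tree p → Tree p) × Tree p => z.1 z.2) ⁻¹' {w}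
        = ⋃ u : Tree p, {f : Tree p → Tree p | f u = w} ×ˢ {u} := by
      ext ⟨f, u⟩
      simp
    rw [this]
    refine isOpen_iUnion fun u => IsOpen.prod ?_ (isOpen_discrete _)
    exact isOpen_discrete_eval u w
  have hC : IsCompact C := by
    have hcS : IsCompact (Set.univ.pi S) := isCompact_univ_pi fun x => (hfin x).isCompact
    refine (hcS.prod hcS).inter_right ?_
    simp only [Set.ofPred_and, Set.ofPred_forall]
    have c1 : ∀ v, Continuous fun f : (Tree p → Tree p) × (Tree p → Tree p) => f.1 v :=
      fun v => (continuous_apply v).comp continuous_fst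
    have c2 : ∀ v, Continuous fun f : (Tree p → Tree p) × (Tree p → Tree p) => f.2 v :=
      fun v => (continuous_apply v).comp continuous_snd
    refine (isClosed_eq (c1 _) continuous_const).inter
      ((isClosed_iInter fun x => ?_).inter ((isClosed_iInter fun x => ?_).inter
        (isClosed_iInter fun x => ?_)))
    · exact isClosed_eq (hev.comp (continuous_fst.prodMk (c2 x))) continuous_const
    · exact isClosed_eq (hev.comp (continuous_snd.prodMk (c1 x))) continuous_const
    · exact isClosed_eq (c1 _)
        ((continuous_of_discreteTopology (f := (Tree.pred : Tree p → Tree p))).comp (c1 x))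
  have himg : ι '' K = C := by
    ext ⟨f, k⟩
    constructor
    · rintro ⟨g, hg, h⟩
      obtain ⟨rfl, rfl⟩ := Prod.mk.inj h
      have hg' : g⁻¹.1 Tree.root = Tree.root := by
        have := g.1.symm_apply_apply Tree.root
        rw [hg] at this
        exact this
      exact ⟨⟨fun x _ => hS x g hg, fun x _ => hS x g⁻¹ hg'⟩, hg,
        fun x => g.1.apply_symm_apply x, fun x => g.1.symm_apply_apply x, g.2⟩
    · rintro ⟨-, h1, h2, h3, h4⟩
      simp only at h1 h2 h3 h4
      have hinj : Function.Injective f := Function.LeftInverse.injective h3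
      refine ⟨⟨⟨⟨f, k, h3, h2⟩, ?_⟩, h4⟩, h1, rfl⟩
      intro a b
      change (f a).pred = f b ∨ (f b).pred = f a ↔ a.pred = b ∨ b.pred = a
      rw [← h4, ← h4, hinj.eq_iff, hinj.eq_iff]
  have hK : IsCompact K := by
    rw [hι.isCompact_iff, himg]
    exact hC
  have hnhds : K ∈ 𝓝 (1 : Aff p) := by
    refine IsOpen.mem_nhds ?_ rfl
    exact (SimpleGraph.isOpen_aut_eval_eq Tree.root Tree.root).preimage continuous_subtype_val
  exact hK.locallyCompactSpace_of_mem_nhds_of_group hnhds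

instance A.locallyCompactSpace (p q : ℕ) [NeZero p] [NeZero q] : LocallyCompactSpace (A p q) := by
  have hc : IsClosed (A p q : Set (Aff p × Aff q)) :=
    isClosed_eq ((Aff.continuous_Phi.comp continuous_fst).add
      (Aff.continuous_Phi.comp continuous_snd)) continuous_const
  exact hc.isClosedEmbedding_subtypeVal.locallyCompactSpace

end DiestelLeader

/-! Modular function. For left Haar measure, `Δ(g)` is the ratio of the measures of `g⁻¹Ug` and `U`.
Take `U = G_{a,b}`, the stabilizer of a vertex `a` of the first tree and a vertex `b` of the second;
it is open, of finite measure, and `g⁻¹Ug` is the stabilizer of `g⁻¹a` and `g⁻¹b`. An affine map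
fixing `a` fixes `a⁻`, and `G_{a⁻,b}` permutes the `p` successors of `a⁻` transitively, so `G_{a,b}`
has index `p` in `G_{a⁻,b}`; likewise `q` in the second tree (`measure_pairStabilizer_pred_left`,
`measure_pairStabilizer_pred_right`). Climbing from `a`, `b` and from `g⁻¹a`, `g⁻¹b` to common
ancestors compares the two measures. The differences between the numbers of steps are `Φ(g)` and
`-Φ(g)`, whence `(p/q)^Φ(g)`. Since `Φ` takes the value `1`, unimodularity means `p = q`.

Amenability. Orient each edge of `DL(p,q)` so that the height in `𝕋_p` increases: every vertex has
`p` outgoing and `q` incoming edges. Edges inside a finite set `F` are counted once at each end, so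
the numbers of oriented edges leaving and entering `F` differ by `|p - q| |F|`, and this bounds
`|∂F|` from below (`abs_sub_mul_card_le`). If `p = q`, a tetrahedron of height `n` has `n + 1`
layers of `p ^ n` vertices, and its boundary edges leave only from the two extreme layers. There are
at most `2 p ^ (n + 1)` of them, so the ratio is at most `2p / (n + 1)`. -/

/-! ### Orbit counting for invariant measures -/

open scoped Pointwise in
/-- Orbit-stabilizer for an invariant measure. -/
theorem measure_subgroup_eq_ncard_orbit_mul {G X : Type*} [Group G] [MulAction G X]
    [MeasurableSpace G] [MeasurableMul G] (μ : Measure G) [μ.IsMulLeftInvariant]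
    (L : Subgroup G) (x : X) (hfin : {y | ∃ g ∈ L, g • x = y}.Finite)
    (hm : MeasurableSet ((L ⊓ MulAction.stabilizer G x : Subgroup G) : Set G)) :
    μ L = {y | ∃ g ∈ L, g • x = y}.ncard * μ (L ⊓ MulAction.stabilizer G x : Subgroup G) := by
  obtain ⟨T, hT⟩ := hfin.exists_finset_coe
  have hmem : ∀ y, y ∈ T ↔ ∃ g ∈ L, g • x = y := fun y => by
    rw [← Finset.mem_coe, hT]; rfl
  -- The fibres of the orbit map are left cosets of the stabilizer, so left invariance gives them
  -- equal measure.
  have hcoset : ∀ y ∈ T, ∃ h : G, {g : G | g ∈ L ∧ g • x = y}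
      = h • ((L ⊓ MulAction.stabilizer G x : Subgroup G) : Set G) := by
    intro y hy
    obtain ⟨h, hL, rfl⟩ := (hmem y).1 hy
    refine ⟨h, Set.ext fun g => ?_⟩
    rw [Set.mem_smul_set_iff_inv_smul_mem]
    simp only [Set.mem_ofPred_eq, smul_eq_mul, SetLike.mem_coe, Subgroup.mem_inf,
      MulAction.mem_stabilizer_iff, mul_smul, inv_smul_eq_iff]
    rw [L.mul_mem_cancel_left (L.inv_mem hL)]
  have hunion : (L : Set G) = ⋃ y ∈ T, {g : G | g ∈ L ∧ g • x = y} := by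
    ext g
    simp only [Set.mem_iUnion, Set.mem_ofPred_eq, SetLike.mem_coe, exists_prop]
    exact ⟨fun hg => ⟨g • x, (hmem _).2 ⟨g, hg, rfl⟩, hg, rfl⟩, fun ⟨_, _, h, _⟩ => h⟩
  have hdisj : (T : Set X).PairwiseDisjoint fun y => {g : G | g ∈ L ∧ g • x = y} := by
    intro y _ z _ hyz
    refine Set.disjoint_left.2 fun g hg hg' => hyz ?_
    rw [← hg.2, ← hg'.2]
  have hmeas : ∀ y ∈ T, MeasurableSet {g : G | g ∈ L ∧ g • x = y} := fun y hy => by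
    obtain ⟨h, hh⟩ := hcoset y hy
    rw [hh]
    exact hm.const_smul h
  conv_lhs => rw [hunion, measure_biUnion_finset hdisj hmeas]
  rw [← hT, Set.ncard_coe_finset, Finset.sum_congr rfl (fun y hy => ?_), Finset.sum_const,
    nsmul_eq_mul]
  obtain ⟨h, hh⟩ := hcoset y hy
  rw [hh, measure_smul]

/-! ### Rotations and shifts in the affine group of the tree -/

namespace DiestelLeader

namespace Tree

variable {p : ℕ}

/-- Add `t` to the label of the ancestor in `H_i` of every vertex on or below `H_i`. -/
def rotate (i : ℤ) (t : ZMod p) (x : Tree p) : Tree p where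
  level := x.level
  digit := fun j => x.digit j + if j = i ∧ i ≤ x.level then t else 0
  digit_above := fun j hj => by rw [x.digit_above j hj, if_neg (by omega), add_zero]
  digit_below := by
    obtain ⟨m, hm⟩ := x.digit_below
    exact ⟨min m i, fun j hj => by rw [hm j (by omega), if_neg (by omega), add_zero]⟩

theorem rotate_pred (i : ℤ) (t : ZMod p) (x : Tree p) : x.pred.rotate i t = (x.rotate i t).pred := by
  refine Tree.ext rfl (funext fun j => ?_)
  simp only [rotate, pred]
  grind

theorem rotate_rotate (i : ℤ) (s t : ZMod p) (x : Tree p) :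
    (x.rotate i s).rotate i t = x.rotate i (s + t) := by
  refine Tree.ext rfl (funext fun j => ?_)
  simp only [rotate]
  split_ifs <;> simp [*, add_assoc]

theorem rotate_zero (i : ℤ) (x : Tree p) : x.rotate i 0 = x := by
  refine Tree.ext rfl (funext fun j => ?_)
  simp [rotate]

theorem rotate_of_lt {i : ℤ} {t : ZMod p} {x : Tree p} (h : x.level < i) : x.rotate i t = x := by
  refine Tree.ext rfl (funext fun j => ?_)
  simp [rotate, h]

theorem level_eq_of_pred_eq {x y : Tree p} (h : x.pred = y.pred) : x.level = y.level := by
  have := congrArg level h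
  simpa [pred] using this

/-- Siblings can differ only in their last label, at position `x.level`. This yields transitivity on
the successors of a vertex. -/
theorem rotate_eq_of_pred_eq {x y : Tree p} (h : x.pred = y.pred) :
    x.rotate x.level (y.digit x.level - x.digit x.level) = y := by
  have hl := level_eq_of_pred_eq h
  refine Tree.ext hl (funext fun j => ?_)
  have hj := congrArg (fun z => z.digit j) h
  simp only [pred, ← hl] at hj
  simp only [rotate]
  rcases lt_trichotomy j x.level with h1 | h1 | h1
  · rw [if_pos (by omega), if_pos (by omega)] at hj
    rw [if_neg (by omega), add_zero, hj]
  · subst h1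
    simp
  · rw [if_neg (by omega), x.digit_above j h1, y.digit_above j (by omega), add_zero]

/-- Move every vertex `n` horocycles down, keeping the labels. -/
def shift (n : ℤ) (x : Tree p) : Tree p where
  level := x.level + n
  digit := fun j => x.digit (j - n)
  digit_above := fun j hj => x.digit_above _ (by omega)
  digit_below := by
    obtain ⟨m, hm⟩ := x.digit_below
    exact ⟨m + n, fun j hj => hm _ (by omega)⟩

theorem shift_pred (n : ℤ) (x : Tree p) : x.pred.shift n = (x.shift n).pred := by
  refine Tree.ext (by simp only [shift, pred]; ring) (funext fun j => ?_)
  simp only [shift, pred]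
  grind

theorem shift_shift (m n : ℤ) (x : Tree p) : (x.shift m).shift n = x.shift (m + n) := by
  refine Tree.ext (by simp only [shift]; ring) (funext fun j => ?_)
  simp only [shift]
  congr 1
  ring

theorem shift_zero (x : Tree p) : x.shift 0 = x := by
  refine Tree.ext (by simp [shift]) (funext fun j => by simp [shift])

end Tree

namespace Aff

variable {p : ℕ}

/-- A bijection commuting with `pred` is an affine automorphism. -/
def ofEquiv (e : Tree p ≃ Tree p) (he : ∀ x, e x.pred = (e x).pred) : Aff p :=
  ⟨⟨e, fun {x y} => by
    change (e x).pred = e y ∨ (e y).pred = e x ↔ x.pred = y ∨ y.pred = x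
    rw [← he, ← he, e.injective.eq_iff, e.injective.eq_iff]⟩, he⟩

/-- The affine automorphism `Tree.rotate`. -/
def rotate (i : ℤ) (t : ZMod p) : Aff p :=
  ofEquiv ⟨Tree.rotate i t, Tree.rotate i (-t),
    fun x => by rw [Tree.rotate_rotate, add_neg_cancel, Tree.rotate_zero],
    fun x => by rw [Tree.rotate_rotate, neg_add_cancel, Tree.rotate_zero]⟩ (Tree.rotate_pred i t)

/-- The affine automorphism `Tree.shift`. -/
def shift (n : ℤ) : Aff p :=
  ofEquiv ⟨Tree.shift n, Tree.shift (-n),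
    fun x => by rw [Tree.shift_shift, add_neg_cancel, Tree.shift_zero],
    fun x => by rw [Tree.shift_shift, neg_add_cancel, Tree.shift_zero]⟩ (Tree.shift_pred n)

theorem Phi_rotate (i : ℤ) (t : ZMod p) : Phi (rotate i t) = 0 := sub_self _

theorem Phi_shift (n : ℤ) : Phi (shift n : Aff p) = n := by
  change (0 : ℤ) + n - 0 = n
  ring

/-- Siblings are exchanged by an affine automorphism fixing their predecessor. -/
theorem exists_apply_eq_of_pred_eq {x y : Tree p} (h : x.pred = y.pred) :
    ∃ g : Aff p, Phi g = 0 ∧ g.1 x.pred = x.pred ∧ g.1 x = y :=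
  ⟨rotate x.level (y.digit x.level - x.digit x.level), Phi_rotate _ _,
    Tree.rotate_of_lt (by simp [Tree.pred]), Tree.rotate_eq_of_pred_eq h⟩

theorem busemann_apply_sub (g : Aff p) (x : Tree p) :
    (g⁻¹.1 x).busemann = x.busemann - Phi g := by
  have := Phi_eq g⁻¹ x
  rw [Phi_inv] at this
  omega

end Aff

/-! ### The action of `𝒜(p,q)` on the two trees and its topology -/

namespace A

variable {p q : ℕ}

/-- The action of `𝒜(p,q)` on the disjoint union of the two trees. -/
instance mulActionSum : MulAction (A p q) (Tree p ⊕ Tree q) where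
  smul g := Sum.map g.1.1.1 g.1.2.1
  one_smul z := by cases z <;> rfl
  mul_smul g h z := by cases z <;> rfl

theorem smul_inl (g : A p q) (a : Tree p) :
    g • (Sum.inl a : Tree p ⊕ Tree q) = Sum.inl (g.1.1.1 a) := rfl

theorem smul_inr (g : A p q) (b : Tree q) :
    g • (Sum.inr b : Tree p ⊕ Tree q) = Sum.inr (g.1.2.1 b) := rfl

theorem isOpen_smul_eq (z w : Tree p ⊕ Tree q) : IsOpen {g : A p q | g • z = w} := by
  rcases z with a | b <;> rcases w with c | d
  · simp only [smul_inl, Sum.inl.injEq]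
    exact (SimpleGraph.isOpen_aut_eval_eq a c).preimage
      (continuous_subtype_val.comp (continuous_fst.comp continuous_subtype_val))
  · simp [smul_inl]
  · simp [smul_inr]
  · simp only [smul_inr, Sum.inr.injEq]
    exact (SimpleGraph.isOpen_aut_eval_eq b d).preimage
      (continuous_subtype_val.comp (continuous_snd.comp continuous_subtype_val))

theorem isOpen_stabilizer (z : Tree p ⊕ Tree q) :
    IsOpen (MulAction.stabilizer (A p q) z : Set (A p q)) := isOpen_smul_eq z z

/-- The action on the two trees induces the topology. -/
theorem isInducing_smul :
    @IsInducing (A p q) (Tree p ⊕ Tree q → Tree p ⊕ Tree q) _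
      (@Pi.topologicalSpace _ _ fun _ => ⊥) (fun g z => g • z) := by
  let _ : TopologicalSpace (Tree p) := ⊥
  let _ : TopologicalSpace (Tree q) := ⊥
  let _ : TopologicalSpace (Tree p ⊕ Tree q) := ⊥
  have _ : DiscreteTopology (Tree p) := ⟨rfl⟩
  have _ : DiscreteTopology (Tree q) := ⟨rfl⟩
  have _ : DiscreteTopology (Tree p ⊕ Tree q) := ⟨rfl⟩
  have h1 : ∀ r : ℕ, @IsInducing (Aff r) (Tree r → Tree r) _
      (@Pi.topologicalSpace _ _ fun _ => ⊥) (fun g v => g.1 v) := by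
    intro r
    let _ : TopologicalSpace (Tree r) := ⊥
    exact (IsInducing.mk rfl : IsInducing
      (fun (g : Tree.graph r ≃g Tree.graph r) (v : Tree r) => g v)).comp IsInducing.subtypeVal
  have h2 : IsInducing fun g : A p q =>
      ((fun v => g.1.1.1 v, fun v => g.1.2.1 v) : (Tree p → Tree p) × (Tree q → Tree q)) :=
    ((h1 p).prodMap (h1 q)).comp IsInducing.subtypeVal
  refine ⟨le_antisymm ?_ ?_⟩
  · refine continuous_iff_le_induced.1 (continuous_pi fun z => ?_)
    exact continuous_discrete_rng.2 fun w => isOpen_smul_eq z w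
  -- Recover the pair of maps from a map of the disjoint union. The default `Tree.root` serves only
  -- maps that send a vertex into the other tree, which no group element does.
  · have hc : Continuous fun f : Tree p ⊕ Tree q → Tree p ⊕ Tree q =>
        ((fun v => (f (.inl v)).elim id fun _ => Tree.root,
          fun v => (f (.inr v)).elim (fun _ => Tree.root) id) :
          (Tree p → Tree p) × (Tree q → Tree q)) :=
      (continuous_pi fun v => (continuous_of_discreteTopology
        (f := fun z : Tree p ⊕ Tree q => z.elim id fun _ => Tree.root)).comp
          (continuous_apply _)).prodMk
      (continuous_pi fun v => (continuous_of_discreteTopology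
        (f := fun z : Tree p ⊕ Tree q => z.elim (fun _ => Tree.root) id)).comp
          (continuous_apply _))
    rw [h2.eq_induced]
    refine (induced_mono hc.le_induced).trans_eq ?_
    rw [induced_compose]
    rfl

/-- The pointwise stabilizers of finite sets form a basis of neighbourhoods of the identity. -/
theorem exists_finset_of_mem_nhds_one {U : Set (A p q)} (hU : U ∈ 𝓝 (1 : A p q)) :
    ∃ F : Finset (Tree p ⊕ Tree q), ∀ g : A p q, (∀ z ∈ F, g • z = z) → g ∈ U := by
  let _ : TopologicalSpace (Tree p ⊕ Tree q) := ⊥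
  have _ : DiscreteTopology (Tree p ⊕ Tree q) := ⟨rfl⟩
  rw [isInducing_smul.nhds_eq_comap, Filter.mem_comap] at hU
  obtain ⟨V, hV, hVU⟩ := hU
  rw [nhds_pi, Filter.mem_pi'] at hV
  obtain ⟨F, t, ht, hF⟩ := hV
  refine ⟨F, fun g hg => hVU (hF fun z hz => ?_)⟩
  have := mem_of_mem_nhds (ht z)
  rw [one_smul] at this
  change g • z ∈ t z
  rwa [hg z hz]

/-- The stabilizer of a vertex in each of the two trees. -/
def pairStabilizer (a : Tree p) (b : Tree q) : Subgroup (A p q) :=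
  MulAction.stabilizer (A p q) (Sum.inl a : Tree p ⊕ Tree q) ⊓
    MulAction.stabilizer (A p q) (Sum.inr b : Tree p ⊕ Tree q)

theorem mem_pairStabilizer {a : Tree p} {b : Tree q} {g : A p q} :
    g ∈ pairStabilizer a b ↔ g.1.1.1 a = a ∧ g.1.2.1 b = b := by
  simp [pairStabilizer, MulAction.mem_stabilizer_iff, smul_inl, smul_inr]

theorem isOpen_pairStabilizer (a : Tree p) (b : Tree q) :
    IsOpen (pairStabilizer a b : Set (A p q)) :=
  (isOpen_stabilizer _).inter (isOpen_stabilizer _)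

/-! ### Haar measure of the vertex stabilizers -/

section Measure

variable [NeZero p] [NeZero q] [MeasurableSpace (A p q)] [BorelSpace (A p q)]
  (μ : Measure (A p q))

/-- A compact neighbourhood of the identity contains the pointwise stabilizer of some finite set
`F`. Adding the points of `F` one at a time cuts `L` down to a subgroup of that stabilizer, with
finite index at each step because orbits are finite. -/
theorem measure_lt_top_of_finite_orbits [IsHaarMeasure μ] (L : Subgroup (A p q))
    (hL : IsOpen (L : Set (A p q)))
    (hfin : ∀ z : Tree p ⊕ Tree q, {y | ∃ g ∈ L, g • z = y}.Finite) : μ L < ⊤ := by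
  obtain ⟨C, hC, hC1⟩ := exists_compact_mem_nhds (1 : A p q)
  obtain ⟨F, hF⟩ := exists_finset_of_mem_nhds_one hC1
  -- `L` is quantified inside the induction since each step replaces it by `L ⊓ stabilizer z`.
  have key : ∀ F : Finset (Tree p ⊕ Tree q), ∀ L : Subgroup (A p q), IsOpen (L : Set (A p q)) →
      (∀ z : Tree p ⊕ Tree q, {y | ∃ g ∈ L, g • z = y}.Finite) →
      μ {g | g ∈ L ∧ ∀ z ∈ F, g • z = z} < ⊤ → μ L < ⊤ := by
    intro F
    induction F using Finset.cons_induction with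
    | empty => simp
    | cons z F hz ih =>
      intro L hL hfin h
      have ho : IsOpen ((L ⊓ MulAction.stabilizer (A p q) z : Subgroup (A p q)) : Set (A p q)) :=
        hL.inter (isOpen_stabilizer z)
      rw [measure_subgroup_eq_ncard_orbit_mul μ L z (hfin z) ho.measurableSet]
      refine ENNReal.mul_lt_top (ENNReal.natCast_lt_top _) (ih _ ho (fun w => ?_) ?_)
      · exact (hfin w).subset fun y ⟨g, hg, hy⟩ => ⟨g, hg.1, hy⟩
      · refine lt_of_le_of_lt (measure_mono ?_) h
        refine fun g hg => ⟨hg.1.1, fun w hw => ?_⟩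
        rcases Finset.mem_cons.1 hw with rfl | hw
        · exact hg.1.2
        · exact hg.2 w hw
  exact key F L hL hfin ((measure_mono fun g hg => hF g hg.2).trans_lt hC.measure_lt_top)

theorem measure_pairStabilizer_root_lt_top [IsHaarMeasure μ] :
    μ (pairStabilizer (Tree.root : Tree p) (Tree.root : Tree q)) < ⊤ := by
  refine measure_lt_top_of_finite_orbits μ _ (isOpen_pairStabilizer _ _) fun z => ?_
  rcases z with a | b
  · obtain ⟨S, hS, h⟩ := Tree.exists_finite_orbit a
    refine (hS.image Sum.inl).subset ?_
    rintro _ ⟨g, hg, rfl⟩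
    exact ⟨_, h g.1.1 (mem_pairStabilizer.1 hg).1, rfl⟩
  · obtain ⟨S, hS, h⟩ := Tree.exists_finite_orbit b
    refine (hS.image Sum.inr).subset ?_
    rintro _ ⟨g, hg, rfl⟩
    exact ⟨_, h g.1.2 (mem_pairStabilizer.1 hg).2, rfl⟩

variable [IsMulLeftInvariant μ]

-- Orbit-stabilizer for `a` under the stabilizer of `a⁻` and `b`. The orbit consists of all `p`
-- successors of `a⁻`, because a rotation of the first tree paired with the identity of the second
-- lies in `𝒜(p,q)`. What fixes `a` already fixes `a⁻`.
omit [NeZero q] in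
theorem measure_pairStabilizer_pred_left (a : Tree p) (b : Tree q) :
    μ (pairStabilizer a.pred b) = p * μ (pairStabilizer a b) := by
  have horb : {y : Tree p ⊕ Tree q | ∃ g ∈ pairStabilizer a.pred b, g • Sum.inl a = y}
      = Sum.inl '' {y : Tree p | y.pred = a.pred} := by
    ext y
    constructor
    · rintro ⟨g, hg, rfl⟩
      refine ⟨g.1.1.1 a, ?_, rfl⟩
      rw [Set.mem_ofPred_eq, ← g.1.1.2, (mem_pairStabilizer.1 hg).1]
    · rintro ⟨y, hy, rfl⟩
      obtain ⟨g, h0, h1, h2⟩ := Aff.exists_apply_eq_of_pred_eq (Eq.symm hy : a.pred = y.pred)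
      refine ⟨⟨(g, 1), ?_⟩, mem_pairStabilizer.2 ⟨h1, rfl⟩, congrArg Sum.inl h2⟩
      change Aff.Phi g + Aff.Phi 1 = 0
      rw [h0, Aff.Phi_one, add_zero]
  have hinf : pairStabilizer a.pred b ⊓ MulAction.stabilizer (A p q) (Sum.inl a : Tree p ⊕ Tree q)
      = pairStabilizer a b := by
    ext g
    simp only [Subgroup.mem_inf, mem_pairStabilizer, MulAction.mem_stabilizer_iff, smul_inl,
      Sum.inl.injEq]
    refine ⟨fun h => ⟨h.2, h.1.2⟩, fun h => ⟨⟨?_, h.2⟩, h.1⟩⟩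
    rw [g.1.1.2, h.1]
  have hcard : {y : Tree p | y.pred = a.pred}.ncard = p := Tree.card_successors a.pred
  have := measure_subgroup_eq_ncard_orbit_mul μ (pairStabilizer a.pred b)
    (Sum.inl a : Tree p ⊕ Tree q)
    (by rw [horb]; exact (Tree.finite_pred_fiber 1 a.pred).image _)
    (by rw [hinf]; exact (isOpen_pairStabilizer a b).measurableSet)
  rwa [horb, hinf, Set.ncard_image_of_injective _ Sum.inl_injective, hcard] at this

omit [NeZero p] in
theorem measure_pairStabilizer_pred_right (a : Tree p) (b : Tree q) :
    μ (pairStabilizer a b.pred) = q * μ (pairStabilizer a b) := by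
  have horb : {y : Tree p ⊕ Tree q | ∃ g ∈ pairStabilizer a b.pred, g • Sum.inr b = y}
      = Sum.inr '' {y : Tree q | y.pred = b.pred} := by
    ext y
    constructor
    · rintro ⟨g, hg, rfl⟩
      refine ⟨g.1.2.1 b, ?_, rfl⟩
      rw [Set.mem_ofPred_eq, ← g.1.2.2, (mem_pairStabilizer.1 hg).2]
    · rintro ⟨y, hy, rfl⟩
      obtain ⟨g, h0, h1, h2⟩ := Aff.exists_apply_eq_of_pred_eq (Eq.symm hy : b.pred = y.pred)
      refine ⟨⟨(1, g), ?_⟩, mem_pairStabilizer.2 ⟨rfl, h1⟩, congrArg Sum.inr h2⟩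
      change Aff.Phi 1 + Aff.Phi g = 0
      rw [h0, Aff.Phi_one, add_zero]
  have hinf : pairStabilizer a b.pred ⊓ MulAction.stabilizer (A p q) (Sum.inr b : Tree p ⊕ Tree q)
      = pairStabilizer a b := by
    ext g
    simp only [Subgroup.mem_inf, mem_pairStabilizer, MulAction.mem_stabilizer_iff, smul_inr,
      Sum.inr.injEq]
    refine ⟨fun h => ⟨h.1.1, h.2⟩, fun h => ⟨⟨h.1, ?_⟩, h.2⟩⟩
    rw [g.1.2.2, h.2]
  have hcard : {y : Tree q | y.pred = b.pred}.ncard = q := Tree.card_successors b.pred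
  have := measure_subgroup_eq_ncard_orbit_mul μ (pairStabilizer a b.pred)
    (Sum.inr b : Tree p ⊕ Tree q)
    (by rw [horb]; exact (Tree.finite_pred_fiber 1 b.pred).image _)
    (by rw [hinf]; exact (isOpen_pairStabilizer a b).measurableSet)
  rwa [horb, hinf, Set.ncard_image_of_injective _ Sum.inr_injective, hcard] at this

/-- Used for two pairs of vertices with common ancestors, this compares the measures of their
stabilizers. -/
theorem measure_pairStabilizer_iterate_pred (m n : ℕ) (a : Tree p) (b : Tree q) :
    μ (pairStabilizer (Tree.pred^[m] a) (Tree.pred^[n] b))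
      = p ^ m * q ^ n * μ (pairStabilizer a b) := by
  induction m with
  | zero =>
    induction n with
    | zero => simp
    | succ n ih =>
      rw [Function.iterate_succ_apply' _ n, measure_pairStabilizer_pred_right, ih]
      ring
  | succ m ih =>
    rw [Function.iterate_succ_apply' _ m, measure_pairStabilizer_pred_left, ih]
    ring

end Measure

end A

end DiestelLeader

/-! ### The modular function and unimodularity -/

/-- The set on the right is `g⁻¹Ug`, which has the measure of `Ug` by left invariance. For a
subgroup `U` it is again a subgroup, so subgroup indices can compute `Δ`. -/
theorem modularFunction_mul_measure_of_isOpen {G : Type*} [Group G] [TopologicalSpace G]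
    [IsTopologicalGroup G] [LocallyCompactSpace G] [MeasurableSpace G] [BorelSpace G]
    (μ : Measure G) [IsHaarMeasure μ] {U : Set G} (hU : IsOpen U) (g : G) :
    modularFunction g * μ U = μ ((fun x => g * x * g⁻¹) ⁻¹' U) := by
  have h3 := measure_isHaarMeasure_eq_smul_of_isOpen (Measure.map (· * g⁻¹) μ) μ hU
  rw [Measure.map_apply (measurable_mul_const _) hU.measurableSet] at h3
  rw [← measure_preimage_mul μ g] at h3
  have h4 : (fun x => g * x * g⁻¹) ⁻¹' U = (g * ·) ⁻¹' ((· * g⁻¹) ⁻¹' U) := rfl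
  rw [h4, h3, modularFunction]
  change (modularCharacterFun g⁻¹ : ℝ≥0∞) * μ U = _
  rw [modularCharacterFun_eq_haarScalarFactor μ]
  rfl

namespace DiestelLeader

namespace A

variable {p q : ℕ} [NeZero p] [NeZero q]

theorem modularFunction_eq (g : A p q) :
    (modularFunction g : ℝ) = ((p : ℝ) / (q : ℝ)) ^ (A.Phi g) := by
  let _ : MeasurableSpace (A p q) := borel _
  have _ : BorelSpace (A p q) := ⟨rfl⟩
  let μ : Measure (A p q) := haar
  let a : Tree p := Tree.root
  let b : Tree q := Tree.root
  obtain ⟨i, j, hij⟩ := Tree.exists_common_ancestor (g.1.1⁻¹.1 a) a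
  obtain ⟨k, l, hkl⟩ := Tree.exists_common_ancestor (g.1.2⁻¹.1 b) b
  -- The two sides of `hij` lie in the same horocycle, and `g⁻¹` changes heights in the first tree
  -- by `-Φ(g)`.
  have h1 : (j : ℤ) - i = Phi g := by
    have := congrArg Tree.busemann hij
    rw [Tree.busemann_iterate_pred, Tree.busemann_iterate_pred, Aff.busemann_apply_sub] at this
    rw [Phi]
    omega
  have h2 : (l : ℤ) - k = - Phi g := by
    have := congrArg Tree.busemann hkl
    rw [Tree.busemann_iterate_pred, Tree.busemann_iterate_pred, Aff.busemann_apply_sub] at this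
    rw [Phi_eq_neg]
    omega
  have h3 := measure_pairStabilizer_iterate_pred μ i k (g.1.1⁻¹.1 a) (g.1.2⁻¹.1 b)
  rw [hij, hkl, measure_pairStabilizer_iterate_pred μ j l a b] at h3
  -- Conjugating a stabilizer gives the stabilizer of the translated vertices.
  have h4 : (fun x => g * x * g⁻¹) ⁻¹' (pairStabilizer a b : Set (A p q))
      = pairStabilizer (g.1.1⁻¹.1 a) (g.1.2⁻¹.1 b) := by
    ext x
    simp only [Set.mem_preimage, SetLike.mem_coe, mem_pairStabilizer]
    change g.1.1.1 (x.1.1.1 (g.1.1⁻¹.1 a)) = a ∧ g.1.2.1 (x.1.2.1 (g.1.2⁻¹.1 b)) = b ↔ _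
    exact and_congr g.1.1.1.toEquiv.eq_symm_apply.symm
      g.1.2.1.toEquiv.eq_symm_apply.symm
  have h5 := modularFunction_mul_measure_of_isOpen μ (isOpen_pairStabilizer a b) g
  rw [h4] at h5
  rw [← h5] at h3
  -- Cancelling this measure in `[0, ∞]` requires it to be positive and finite.
  have hpos : μ (pairStabilizer a b) ≠ 0 :=
    ((isOpen_pairStabilizer a b).measure_pos μ ⟨1, one_mem _⟩).ne'
  have hfin : μ (pairStabilizer a b) ≠ ⊤ := (measure_pairStabilizer_root_lt_top μ).ne
  rw [← mul_assoc, ENNReal.mul_left_inj hpos hfin] at h3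
  have h6 : (p : ℝ) ^ j * (q : ℝ) ^ l = (p : ℝ) ^ i * (q : ℝ) ^ k * modularFunction g := by
    have := congrArg ENNReal.toReal h3
    simpa using this
  have hp : (p : ℝ) ≠ 0 := NeZero.ne _
  have hq : (q : ℝ) ≠ 0 := NeZero.ne _
  have h7 : ((p : ℝ) / q) ^ Phi g = (p : ℝ) ^ ((j : ℤ) - i) * (q : ℝ) ^ ((l : ℤ) - k) := by
    rw [h1, h2, div_zpow, zpow_neg, div_eq_mul_inv]
  rw [h7, zpow_sub₀ hp, zpow_sub₀ hq]
  simp only [zpow_natCast]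
  field_simp
  linarith

theorem isUnimodularGroup_iff : IsUnimodularGroup (A p q) ↔ p = q := by
  have hq : (q : ℝ) ≠ 0 := NeZero.ne _
  constructor
  -- An element with `Φ = 1`, for which `Δ = p / q`.
  · intro h
    have h1 := modularFunction_eq (⟨(Aff.shift 1, Aff.shift (-1)), by
      change Aff.Phi _ + Aff.Phi _ = 0
      rw [Aff.Phi_shift, Aff.Phi_shift]; rfl⟩ : A p q)
    rw [h, Phi, Aff.Phi_shift, zpow_one, NNReal.coe_one, eq_comm, div_eq_one_iff_eq hq] at h1
    exact_mod_cast h1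
  · rintro rfl g
    have h1 := modularFunction_eq g
    rw [div_self hq, one_zpow] at h1
    exact_mod_cast h1

end A

end DiestelLeader

/-! ### The isoperimetric inequality of `DL(p,q)` -/

namespace DiestelLeader

theorem Tree.ncard_pred_fiber {p : ℕ} [NeZero p] (n : ℕ) (a : Tree p) :
    {y : Tree p | pred^[n] y = a}.ncard = p ^ n := by
  induction n generalizing a with
  | zero => simp
  | succ n ih =>
    have h1 : {y : Tree p | y.pred = a}.Finite := finite_pred_fiber 1 a
    have h2 : h1.toFinset.card = p := by
      rw [← Set.ncard_eq_toFinset_card _ h1]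
      exact card_successors a
    classical
    have h3 : {y : Tree p | pred^[n + 1] y = a}
        = ↑(h1.toFinset.biUnion fun b => (finite_pred_fiber n b).toFinset) := by
      ext y
      simp [Function.iterate_succ_apply']
    rw [h3, Set.ncard_coe_finset, Finset.card_biUnion]
    · rw [Finset.sum_congr rfl (fun b _ => ?_), Finset.sum_const, h2, smul_eq_mul, pow_succ,
        mul_comm]
      exact (Set.ncard_eq_toFinset_card _ (finite_pred_fiber n _)).symm.trans (ih _)
    · intro b _ c _ hbc
      rw [Function.onFun, Finset.disjoint_left]
      intro y hy hy'
      simp only [Set.Finite.mem_toFinset, Set.mem_ofPred_eq] at hy hy'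
      exact hbc (hy.symm.trans hy')

namespace DL

variable {p q : ℕ}

/-- The oriented edges of `DL(p,q)`: go down in `𝕋_p` and up in `𝕋_q`. -/
def Up (x y : DLVertex p q) : Prop := y.1.1.pred = x.1.1 ∧ y.1.2 = x.1.2.pred

theorem adj_of_up {x y : DLVertex p q} (h : Up x y) : (DL p q).Adj x y :=
  ⟨Or.inr h.1, Or.inl h.2.symm⟩

theorem adj_iff {x y : DLVertex p q} : (DL p q).Adj x y ↔ Up x y ∨ Up y x := by
  refine ⟨?_, fun h => h.elim adj_of_up fun h => (adj_of_up h).symm⟩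
  have hx := x.2
  have hy := y.2
  have b1 := Tree.busemann_pred (p := p)
  have b2 := Tree.busemann_pred (p := q)
  rintro ⟨h1 | h1, h2 | h2⟩
  -- Heights cannot drop in both trees at once, since they sum to zero at `x` and at `y`; the last
  -- case is symmetric.
  · have := b1 x.1.1
    have := b2 x.1.2
    rw [h1] at *
    rw [h2] at *
    omega
  · exact Or.inr ⟨h1, h2.symm⟩
  · exact Or.inl ⟨h1, h2.symm⟩
  · have := b1 y.1.1
    have := b2 y.1.2
    rw [h1] at *
    rw [h2] at *
    omega

/-- The second coordinate of `y` is forced to be the predecessor, so `y` amounts to a choice of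
successor in `𝕋_p`. -/
theorem ncard_up_right (x : DLVertex p q) : {y | Up x y}.ncard = p := by
  refine (Nat.card_congr (β := {y : Tree p // y.pred = x.1.1}) ?_).trans (Tree.card_successors _)
  refine
    { toFun := fun y => ⟨y.1.1.1, y.2.1⟩
      invFun := fun y => ⟨⟨(y.1, x.1.2.pred), ?_⟩, y.2, rfl⟩
      left_inv := ?_
      right_inv := fun _ => rfl }
  · have h := x.2
    have h1 := Tree.busemann_pred y.1
    have h2 := Tree.busemann_pred x.1.2
    rw [y.2] at h1
    simp only
    omega
  · rintro ⟨y, hy⟩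
    exact Subtype.ext (Subtype.ext (Prod.ext rfl hy.2.symm))

theorem ncard_up_left (x : DLVertex p q) : {y | Up y x}.ncard = q := by
  refine (Nat.card_congr (β := {y : Tree q // y.pred = x.1.2}) ?_).trans (Tree.card_successors _)
  refine
    { toFun := fun y => ⟨y.1.1.2, y.2.2.symm⟩
      invFun := fun y => ⟨⟨(x.1.1.pred, y.1), ?_⟩, rfl, y.2.symm⟩
      left_inv := ?_
      right_inv := fun _ => rfl }
  · have h := x.2
    have h1 := Tree.busemann_pred y.1
    have h2 := Tree.busemann_pred x.1.1
    rw [y.2] at h1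
    simp only
    omega
  · rintro ⟨y, hy⟩
    exact Subtype.ext (Subtype.ext (Prod.ext hy.1 rfl))

variable [NeZero p] [NeZero q]

/-- If every vertex has `k` out-edges, those leaving `F` and those inside `F` number `k * |F|`. -/
theorem sum_ncard_out_add {V : Type*} (F : Finset V) (R : V → V → Prop) (k : ℕ) (hk : k ≠ 0)
    (hR : ∀ x, {y | R x y}.ncard = k) :
    {e : V × V | R e.1 e.2 ∧ e.1 ∈ F ∧ e.2 ∉ F}.ncard
      + {e : V × V | R e.1 e.2 ∧ e.1 ∈ F ∧ e.2 ∈ F}.ncard = k * F.card := by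
  classical
  -- `ncard` is `0` on infinite sets, so `k ≠ 0` is what guarantees finiteness.
  have hfin : ∀ x, {y | R x y}.Finite := fun x => Set.finite_of_ncard_ne_zero (by rwa [hR])
  let E : Finset (V × V) := (F.sigma fun x => (hfin x).toFinset).map
    (Equiv.sigmaEquivProd V V).toEmbedding
  have hE : ∀ e : V × V, e ∈ E ↔ e.1 ∈ F ∧ R e.1 e.2 := by
    rintro ⟨x, y⟩
    simp [E]
  have hcard : E.card = k * F.card := by
    rw [Finset.card_map, Finset.card_sigma, Finset.sum_congr rfl (fun x _ => ?_),
      Finset.sum_const, smul_eq_mul, mul_comm]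
    rw [← Set.ncard_eq_toFinset_card _ (hfin x), hR]
  rw [← hcard, ← Finset.card_filter_add_card_filter_not (s := E) (fun e => e.2 ∉ F),
    ← Set.ncard_coe_finset, ← Set.ncard_coe_finset]
  congr 2 <;> ext e <;> simp [hE] <;> tauto

/-- The isoperimetric inequality of `DL(p,q)`. -/
theorem abs_sub_mul_card_le (F : Finset (DLVertex p q)) :
    |(p : ℝ) - q| * F.card ≤ ((DL p q).edgeBoundary F).ncard := by
  have h1 := sum_ncard_out_add F Up p (NeZero.ne p) ncard_up_right
  have h2 := sum_ncard_out_add F (fun x y => Up y x) q (NeZero.ne q) ncard_up_left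
  -- Reversal matches the internal edges counted at their heads with those counted at their tails,
  -- so they cancel in `h1 - h2`.
  have h3 : {e : DLVertex p q × DLVertex p q | Up e.2 e.1 ∧ e.1 ∈ F ∧ e.2 ∈ F}.ncard
      = {e : DLVertex p q × DLVertex p q | Up e.1 e.2 ∧ e.1 ∈ F ∧ e.2 ∈ F}.ncard := by
    rw [← Set.ncard_image_of_injective _ Prod.swap_injective]
    congr 1
    ext ⟨x, y⟩
    simp only [Set.mem_image, Set.mem_ofPred_eq, Prod.exists, Prod.swap_prod_mk, Prod.mk.injEq]
    constructor
    · rintro ⟨_, _, h, rfl, rfl⟩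
      tauto
    · intro h
      exact ⟨y, x, by tauto, rfl, rfl⟩
  rw [h3] at h2
  have hb := DL_edgeBoundary_finite F
  have h4 := Set.ncard_le_ncard (t := (DL p q).edgeBoundary F)
    (s := {e | Up e.1 e.2 ∧ e.1 ∈ F ∧ e.2 ∉ F}) (fun e he => And.intro (adj_iff.2 (Or.inl he.1)) he.2) hb
  have h5 := Set.ncard_le_ncard (t := (DL p q).edgeBoundary F)
    (s := {e | Up e.2 e.1 ∧ e.1 ∈ F ∧ e.2 ∉ F}) (fun e he => And.intro (adj_iff.2 (Or.inr he.1)) he.2) hb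
  rify at h1 h2 h4 h5
  rw [← abs_of_nonneg (Nat.cast_nonneg F.card : (0 : ℝ) ≤ F.card), ← abs_mul, abs_le]
  constructor <;> nlinarith [Nat.cast_nonneg (α := ℝ)
    {e : DLVertex p q × DLVertex p q | Up e.1 e.2 ∧ e.1 ∈ F ∧ e.2 ∉ F}.ncard,
    Nat.cast_nonneg (α := ℝ)
    {e : DLVertex p q × DLVertex p q | Up e.2 e.1 ∧ e.1 ∈ F ∧ e.2 ∉ F}.ncard]

theorem eq_of_isAmenable (h : (DL p q).IsAmenable) : p = q := by
  by_contra hpq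
  have hpos : 0 < |(p : ℝ) - q| := abs_pos.2 (sub_ne_zero.2 (by exact_mod_cast hpq))
  have hle : |(p : ℝ) - q| ≤ sInf {r : ℝ | ∃ F : Finset (DLVertex p q), F.Nonempty ∧
      r = ((DL p q).edgeBoundary F).ncard / F.card} := by
    refine le_csInf ⟨_, {⟨(Tree.root, Tree.root), rfl⟩}, Finset.singleton_nonempty _, rfl⟩ ?_
    rintro _ ⟨F, hF, rfl⟩
    rw [le_div_iff₀ (by exact_mod_cast hF.card_pos)]
    exact abs_sub_mul_card_le F
  exact absurd (h ▸ hle) (not_le.2 hpos)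

end DL

end DiestelLeader

/-! ### Tetrahedra as Følner sets when `p = q` -/

namespace DiestelLeader

namespace DL

variable {p : ℕ}

/-- The `k`-th layer of the tetrahedron of height `n` spanned by `a` and `b`. -/
def layer (a b : Tree p) (n k : ℕ) : Set (DLVertex p p) :=
  {x | Tree.pred^[k] x.1.1 = a ∧ Tree.pred^[n - k] x.1.2 = b}

theorem busemann_of_mem_layer {a b : Tree p} {n k : ℕ} {x : DLVertex p p}
    (hx : x ∈ layer a b n k) : x.1.1.busemann = a.busemann + k := by
  rw [← hx.1, Tree.busemann_iterate_pred]
  ring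

variable [NeZero p]

theorem finite_layer (a b : Tree p) (n k : ℕ) : (layer a b n k).Finite :=
  (((Tree.finite_pred_fiber k a).prod (Tree.finite_pred_fiber (n - k) b)).preimage
    Subtype.val_injective.injOn).subset fun _ hx => hx

/-- The height condition `hab` makes every pair from the two fibres a vertex of the graph, so the
layer is a full product of sizes `p ^ k` and `p ^ (n - k)`. -/
theorem ncard_layer {a b : Tree p} {n k : ℕ} (hab : a.busemann + b.busemann = -n) (hk : k ≤ n) :
    (layer a b n k).ncard = p ^ n := by
  have himg : Subtype.val '' layer a b n k
      = {y | Tree.pred^[k] y = a} ×ˢ {y | Tree.pred^[n - k] y = b} := by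
    ext ⟨y, z⟩
    constructor
    · rintro ⟨x, hx, h⟩
      rw [← h]
      exact hx
    · rintro ⟨hy, hz⟩
      refine ⟨⟨(y, z), ?_⟩, ⟨hy, hz⟩, rfl⟩
      have h1 := congrArg Tree.busemann (show Tree.pred^[k] y = a from hy)
      have h2 := congrArg Tree.busemann (show Tree.pred^[n - k] z = b from hz)
      rw [Tree.busemann_iterate_pred] at h1 h2
      simp only
      omega
  rw [← Set.ncard_image_of_injective (layer a b n k) Subtype.val_injective]
  erw [himg]
  rw [Set.ncard_prod,
    Tree.ncard_pred_fiber, Tree.ncard_pred_fiber, ← pow_add, Nat.add_sub_cancel' hk]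

open scoped Classical in
/-- The tetrahedron of height `n` spanned by `a` and `b`. -/
noncomputable def tetrahedron (a b : Tree p) (n : ℕ) : Finset (DLVertex p p) :=
  (Finset.range (n + 1)).biUnion fun k => (finite_layer a b n k).toFinset

theorem mem_tetrahedron {a b : Tree p} {n : ℕ} {x : DLVertex p p} :
    x ∈ tetrahedron a b n ↔ ∃ k ≤ n, x ∈ layer a b n k := by
  simp [tetrahedron]

theorem card_tetrahedron {a b : Tree p} {n : ℕ} (hab : a.busemann + b.busemann = -n) :
    (tetrahedron a b n).card = (n + 1) * p ^ n := by
  classical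
  rw [tetrahedron, Finset.card_biUnion]
  · rw [Finset.sum_congr rfl (fun k hk => ?_), Finset.sum_const, Finset.card_range, smul_eq_mul]
    rw [← Set.ncard_eq_toFinset_card _ (finite_layer a b n k),
      ncard_layer hab (Nat.lt_succ_iff.1 (Finset.mem_range.1 hk))]
  · intro k _ l _ hkl
    rw [Function.onFun, Finset.disjoint_left]
    intro x hx hx'
    have h1 := busemann_of_mem_layer ((Set.Finite.mem_toFinset _).1 hx)
    have h2 := busemann_of_mem_layer ((Set.Finite.mem_toFinset _).1 hx')
    omega

/-- An edge from layer `k` leads to layer `k + 1` or `k - 1`, so it can leave the tetrahedron only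
from `k = n` along the orientation or from `k = 0` against it. -/
theorem edgeBoundary_tetrahedron_subset (a b : Tree p) (n : ℕ) :
    (DL p p).edgeBoundary (tetrahedron a b n) ⊆
      {e | Up e.1 e.2 ∧ Tree.pred^[n + 1] e.2.1.1 = a ∧ e.1.1.2 = b} ∪
      {e | Up e.2 e.1 ∧ Tree.pred^[n + 1] e.2.1.2 = b ∧ e.1.1.1 = a} := by
  rintro ⟨x, y⟩ ⟨hadj, hx, hy⟩
  simp only at hadj hx hy
  obtain ⟨k, hk, hx1, hx2⟩ := mem_tetrahedron.1 hx
  rcases adj_iff.1 hadj with h | h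
  · rcases hk.lt_or_eq with hk | rfl
    · refine absurd (mem_tetrahedron.2 ⟨k + 1, hk, ?_, ?_⟩) hy
      · rw [Function.iterate_succ_apply, h.1, hx1]
      · rw [h.2, ← Function.iterate_succ_apply, ← hx2]
        congr 2
        omega
    · refine Or.inl ⟨h, ?_, ?_⟩
      · simp only [Function.iterate_succ_apply]
        rw [h.1, hx1]
      · simpa using hx2
  · rcases Nat.eq_zero_or_pos k with rfl | hk0
    · refine Or.inr ⟨h, ?_, hx1⟩
      simp only [Function.iterate_succ_apply]
      rw [← h.2]
      exact hx2
    · refine absurd (mem_tetrahedron.2 ⟨k - 1, by omega, ?_, ?_⟩) hy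
      · rw [← h.1, ← Function.iterate_succ_apply, ← hx1]
        congr 2
        omega
      · rw [← hx2, h.2, ← Function.iterate_succ_apply]
        congr 2
        omega

theorem ncard_edgeBoundary_tetrahedron_le (a b : Tree p) (n : ℕ) :
    ((DL p p).edgeBoundary (tetrahedron a b n)).ncard ≤ 2 * p ^ (n + 1) := by
  let S : Set (DLVertex p p × DLVertex p p) :=
    {e | Up e.1 e.2 ∧ Tree.pred^[n + 1] e.2.1.1 = a ∧ e.1.1.2 = b}
  let T : Set (DLVertex p p × DLVertex p p) :=
    {e | Up e.2 e.1 ∧ Tree.pred^[n + 1] e.2.1.2 = b ∧ e.1.1.1 = a}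
  -- The outer endpoint's vertex in the first tree determines the edge: its predecessor is the inner
  -- one, and the second coordinates are `b` and `b⁻`. For `T` the trees exchange roles.
  have hSinj : Set.InjOn (fun e : DLVertex p p × DLVertex p p => e.2.1.1) S := by
    rintro ⟨x, y⟩ ⟨h1, -, h2⟩ ⟨x', y'⟩ ⟨h1', -, h2'⟩ h
    simp only at h1 h2 h1' h2' h
    refine Prod.ext (Subtype.ext (Prod.ext ?_ (h2.trans h2'.symm)))
      (Subtype.ext (Prod.ext h ?_))
    · change x.1.1 = x'.1.1
      rw [← h1.1, ← h1'.1, h]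
    · change y.1.2 = y'.1.2
      rw [h1.2, h1'.2, h2, h2']
  have hTinj : Set.InjOn (fun e : DLVertex p p × DLVertex p p => e.2.1.2) T := by
    rintro ⟨x, y⟩ ⟨h1, -, h2⟩ ⟨x', y'⟩ ⟨h1', -, h2'⟩ h
    simp only at h1 h2 h1' h2' h
    refine Prod.ext (Subtype.ext (Prod.ext (h2.trans h2'.symm) ?_))
      (Subtype.ext (Prod.ext ?_ h))
    · change x.1.2 = x'.1.2
      rw [h1.2, h1'.2, h]
    · change y.1.1 = y'.1.1
      rw [← h1.1, ← h1'.1, h2, h2']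
  have hSmaps : Set.MapsTo (fun e : DLVertex p p × DLVertex p p => e.2.1.1) S
    {y | Tree.pred^[n + 1] y = a} := fun e he => he.2.1
  have hTmaps : Set.MapsTo (fun e : DLVertex p p × DLVertex p p => e.2.1.2) T
    {y | Tree.pred^[n + 1] y = b} := fun e he => he.2.1
  have ha := Tree.finite_pred_fiber (n + 1) a
  have hb := Tree.finite_pred_fiber (n + 1) b
  have hS := Set.ncard_le_ncard_of_injOn _ hSmaps hSinj ha
  have hT := Set.ncard_le_ncard_of_injOn _ hTmaps hTinj hb
  have hSfin : S.Finite := ha.of_injOn hSmaps hSinj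
  have hTfin : T.Finite := hb.of_injOn hTmaps hTinj
  rw [Tree.ncard_pred_fiber] at hS hT
  calc _ ≤ (S ∪ T).ncard :=
        Set.ncard_le_ncard (edgeBoundary_tetrahedron_subset a b n) (hSfin.union hTfin)
    _ ≤ S.ncard + T.ncard := Set.ncard_union_le S T
    _ ≤ 2 * p ^ (n + 1) := by omega

theorem isAmenable_self : (DL p p).IsAmenable := by
  have hp : (0 : ℝ) < p := by exact_mod_cast NeZero.pos p
  have hnonneg : ∀ r ∈ {r : ℝ | ∃ F : Finset (DLVertex p p), F.Nonempty ∧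
      r = ((DL p p).edgeBoundary F).ncard / F.card}, 0 ≤ r := by
    rintro _ ⟨F, -, rfl⟩
    positivity
  refine le_antisymm (le_of_forall_pos_le_add fun ε hε => ?_) (Real.sInf_nonneg hnonneg)
  -- This makes the ratio bound `2p / (n + 1)` at most `ε`.
  obtain ⟨n, hn⟩ := exists_nat_gt (2 * p / ε)
  -- Any vertex of height `-n` would do, as the heights of the two spanning vertices must sum to
  -- `-n`.
  let b : Tree p := Tree.pred^[n] Tree.root
  have hab : (Tree.root : Tree p).busemann + b.busemann = -n := by
    rw [Tree.busemann_iterate_pred]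
    change (0 : ℤ) + (0 - n) = -n
    ring
  have hcard := card_tetrahedron hab
  have hpos : 0 < (tetrahedron Tree.root b n).card := by
    rw [hcard]
    exact Nat.mul_pos n.succ_pos (pow_pos (NeZero.pos p) n)
  refine (csInf_le ⟨0, hnonneg⟩ ⟨_, Finset.card_pos.1 hpos, rfl⟩).trans ?_
  have hle : (((DL p p).edgeBoundary (tetrahedron Tree.root b n)).ncard : ℝ)
      ≤ 2 * (p : ℝ) ^ (n + 1) := by
    exact_mod_cast ncard_edgeBoundary_tetrahedron_le Tree.root b n
  rw [zero_add, div_le_iff₀ (by exact_mod_cast hpos), hcard]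
  refine hle.trans ?_
  rw [div_lt_iff₀ hε] at hn
  push_cast
  have h2p : 2 * (p : ℝ) ≤ ε * (n + 1) := by linarith
  calc 2 * (p : ℝ) ^ (n + 1) = (2 * p) * (p : ℝ) ^ n := by ring
    _ ≤ (ε * (n + 1)) * (p : ℝ) ^ n := by gcongr
    _ = ε * ((n + 1) * (p : ℝ) ^ n) := by ring

end DL

end DiestelLeader

theorem mainTheorem4 (p q : ℕ) [NeZero p] [NeZero q] :
    (∀ g : DiestelLeader.A p q,
      (modularFunction g : ℝ) = ((p : ℝ) / (q : ℝ)) ^ (DiestelLeader.A.Phi g)) ∧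
    (IsUnimodularGroup (DiestelLeader.A p q) ↔ p = q) ∧
    ((DiestelLeader.DL p q).IsAmenable ↔ p = q) := by
  refine ⟨DiestelLeader.A.modularFunction_eq, DiestelLeader.A.isUnimodularGroup_iff,
    DiestelLeader.DL.eq_of_isAmenable, ?_⟩
  rintro rfl
  exact DiestelLeader.DL.isAmenable_self
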